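/- **Conventions.** All graphs are finite and simple. For a (possibly infinite) family $\mathcal F$ of graphs, a graph is $\mathcal F$-free if it contains no member of $\mathcal F$ as a (not necessarily induced) subgraph; $e(G)$ is the number of edges of $G$. Let $\mathrm{ex}(n,\mathcal F)$ be the maximum number of edges of an $\mathcal F$-free graph on $n$ vertices, $z(n,\mathcal F)$ the maximum number of edges of a bipartite $\mathcal F$-free graph on $n$ vertices, and $z(m,n,\mathcal F)$ the maximum number of edges of an $\mathcal F$-free bipartite graph with parts of sizes $m$ and $n$. A family $\mathcal F$ of bipartite graphs is $(\alpha,\beta)$-smooth with relative density $\rho$ if $z(m,n,\mathcal F)=\rho\, m\, n^{\alpha-1}+O(n^{\beta})$ uniformly over all $m\le n$. A family $\mathcal G$ of graphs is *extremal $\mathcal F$-free* if every $n$-vertex $G\in\mathcal G$ is $\mathcal F$-free with $e(G)=\mathrm{ex}(n,\mathcal F)$; it is *asymptotically extremal $\mathcal F$-free* if every $G\in\mathcal G$ is $\mathcal F$-free and $e(G)\ge(1-o(1))\,\mathrm{ex}(n,\mathcal F)$ for the $n$-vertex $G\in\mathcal G$ as $n\to\infty$. A family $\mathcal G$ is *near-bipartite*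 if every $n$-vertex $G\in\mathcal G$ has a bipartite subgraph $H$ with $e(H)\ge(1-o(1))\,e(G)$ as $n\to\infty$. **Theorem.** Let $1\le\beta<\alpha<2$, let $\rho>0$, and let $\mathcal F$ be a family of bipartite graphs that is $(\alpha,\beta)$-smooth with relative density $\rho$. Then there is $k_0\in\mathbb N$ such that for every odd $k\ge k_0$: 1. every extremal $\mathcal F\cup\{C_k\}$-free family of graphs is near-bipartite; 2. more generally, every asymptotically extremal $\mathcal F\cup\{C_k\}$-free family of graphs is near-bipartite; 3. $\mathrm{ex}(n,\mathcal F\cup\{C_k\})\sim z(n,\mathcal F)$ as $n\to\infty$. -/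

import Mathlib

open Filter Asymptotics

/-- A family of finite graphs. Every finite graph is represented, up to isomorphism, by a graph
with vertex set `Fin n`. -/
abbrev GraphFamily : Type := Set (Σ n : ℕ, SimpleGraph (Fin n))

namespace GraphFamily

/-- The number of edges of a graph. -/
noncomputable def numEdges {V : Type} (G : SimpleGraph V) : ℕ := G.edgeSet.ncard

/-- `G` is `F`-free: no member of `F` is isomorphic to a (not necessarily induced) subgraph
of `G`. -/
def IsFree (F : GraphFamily) {V : Type} (G : SimpleGraph V) : Prop :=
  ∀ A ∈ F, A.2.Free G

/-- The Turán number `ex(n, F)`: the maximum number of edges in an `F`-free graph on `n`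
vertices. -/
noncomputable def ex (n : ℕ) (F : GraphFamily) : ℕ :=
  sSup {e | ∃ G : SimpleGraph (Fin n), F.IsFree G ∧ numEdges G = e}

/-- `z(n, F)`: the maximum number of edges in a bipartite `F`-free graph on `n` vertices. -/
noncomputable def z (n : ℕ) (F : GraphFamily) : ℕ :=
  sSup {e | ∃ G : SimpleGraph (Fin n), G.IsBipartite ∧ F.IsFree G ∧ numEdges G = e}

/-- `z(m, n, F)`: the maximum number of edges in an `m` by `n` bipartite `F`-free graph, that is,
an `F`-free graph whose edges all join a part of size `m` to a part of size `n`. -/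
noncomputable def zz (m n : ℕ) (F : GraphFamily) : ℕ :=
  sSup {e | ∃ G : SimpleGraph (Fin m ⊕ Fin n),
    G ≤ completeBipartiteGraph (Fin m) (Fin n) ∧ F.IsFree G ∧ numEdges G = e}

/-- `F` is a family of bipartite graphs that is `(α, β)`-smooth with relative density `ρ`:
`z(m, n, F) = ρ m n ^ (α - 1) + O(n ^ β)`, uniformly in `m ≤ n`. -/
def IsSmoothWith (F : GraphFamily) (α β ρ : ℝ) : Prop :=
  (∀ A ∈ F, A.2.IsBipartite) ∧
  ∃ C : ℝ, ∀ m n : ℕ, m ≤ n →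
    |(zz m n F : ℝ) - ρ * (m : ℝ) * (n : ℝ) ^ (α - 1)| ≤ C * (n : ℝ) ^ β

/-- The family whose only member is the cycle `C_k` (for `k ≥ 3`). -/
def cycle (k : ℕ) : GraphFamily := {⟨k, SimpleGraph.cycleGraph k⟩}

/-- `𝒢` is an extremal `F`-free family: each of its members is an `F`-free graph having, for its
number `n` of vertices, exactly `ex(n, F)` edges. -/
def IsExtremal (F 𝒢 : GraphFamily) : Prop :=
  ∀ G ∈ 𝒢, F.IsFree G.2 ∧ numEdges G.2 = ex G.1 F

/-- `𝒢` is an asymptotically extremal `F`-free family: its members are `F`-free, and those on `n`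
vertices have at least `(1 - o(1)) ex(n, F)` edges as `n → ∞`. -/
def IsAsymptoticallyExtremal (F 𝒢 : GraphFamily) : Prop :=
  (∀ G ∈ 𝒢, F.IsFree G.2) ∧
  ∀ ε : ℝ, 0 < ε → ∃ N : ℕ, ∀ G ∈ 𝒢, N ≤ G.1 →
    (1 - ε) * (ex G.1 F : ℝ) ≤ (numEdges G.2 : ℝ)

/-- `𝒢` is near-bipartite: every `n`-vertex member `G` has a bipartite subgraph `H` with
`e(H) ≥ (1 - o(1)) e(G)` as `n → ∞`. -/
def IsNearBipartite (𝒢 : GraphFamily) : Prop :=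
  ∀ ε : ℝ, 0 < ε → ∃ N : ℕ, ∀ G ∈ 𝒢, N ≤ G.1 →
    ∃ H : SimpleGraph (Fin G.1), H ≤ G.2 ∧ H.IsBipartite ∧
      (1 - ε) * (numEdges G.2 : ℝ) ≤ (numEdges H : ℝ)

end GraphFamily

/-! Write w(s) = ρ(s/2)^α. By smoothness z(n, F) is w(n) up to O(n^β), and z ≤ ex since bipartite
graphs have no odd cycles. Everything else rests on `exists_bipartite_subgraph`.

Maximising edges minus a weight (`exists_prune`) leaves s vertices spanning a graph whose degrees
are at least a constant times s^(α-1). There balls grow by a power of s per step until they have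
linear size, since otherwise small sets would carry more edges than smoothness allows; so components
have diameter at most some L (`exists_dist_le`). As L does not depend on k, one may then require k >
2L. Colour the vertices by the parity of their level in a breadth-first forest: a monochromatic edge
lies inside a level. If more than linearly many such edges had ends whose lowest common ancestor is
j steps up, they would contain a path of length k - 2j that closes through the forest to a C_k. So
O(n) edges are monochromatic (`card_level_pairs_le`), which is O(n^β) as β ≥ 1.

The pruning charges w to ordered pairs, hence w/2 to edges: the deleted part has at most half the
extremal density. A graph with nearly w(n) edges can therefore lose only o(w(n)) of them. -/

namespace GraphFamily

/-! ### Cuts, pruning, long paths and cycles -/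

section Counting

open scoped Classical in
/-- The ordered pairs of adjacent vertices with first entry in `A` and second entry in `B`. -/
noncomputable def pairs {V : Type} (G : SimpleGraph V) (A B : Finset V) : Finset (V × V) :=
  (A ×ˢ B).filter fun p => G.Adj p.1 p.2

variable {V : Type}

lemma mem_pairs {G : SimpleGraph V} {A B : Finset V} {p : V × V} :
    p ∈ pairs G A B ↔ p.1 ∈ A ∧ p.2 ∈ B ∧ G.Adj p.1 p.2 := by
  simp [pairs, and_assoc]

lemma card_pairs_univ [Fintype V] (G : SimpleGraph V) :
    (pairs G Finset.univ Finset.univ).card = 2 * numEdges G := by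
  classical
  have h1 : numEdges G = G.edgeFinset.card := by
    rw [numEdges, ← SimpleGraph.coe_edgeFinset, Set.ncard_coe_finset]
  rw [h1, ← SimpleGraph.sum_degrees_eq_twice_card_edges, pairs, Finset.card_filter,
    Finset.sum_product]
  refine Finset.sum_congr rfl fun v _ => ?_
  rw [← Finset.card_filter, SimpleGraph.degree, SimpleGraph.neighborFinset_eq_filter]

lemma card_pairs_comm (G : SimpleGraph V) (A B : Finset V) :
    (pairs G A B).card = (pairs G B A).card := by
  refine Finset.card_bij' (fun p _ => p.swap) (fun p _ => p.swap) ?_ ?_ ?_ ?_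
  all_goals simp +contextual [mem_pairs, SimpleGraph.adj_comm]

lemma numEdges_mono [Finite V] {G H : SimpleGraph V} (h : H ≤ G) : numEdges H ≤ numEdges G :=
  Set.ncard_le_ncard (SimpleGraph.edgeSet_mono h) (Set.toFinite _)

lemma IsFree.of_isContained {F : GraphFamily} {W : Type} {G : SimpleGraph V} {H : SimpleGraph W}
    (hG : F.IsFree G) (h : SimpleGraph.IsContained H G) : F.IsFree H :=
  fun A hA hAH => hG A hA (hAH.trans h)

/-- A random 2-colouring separates each pair of ends with probability 1/2: flipping the colour of `f
e` exchanges the two outcomes. The maps `f`, `g` are arbitrary because ancestors get coloured as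
well as vertices. -/
lemma exists_cut {ι W : Type} [Fintype W] [DecidableEq W] (E : Finset ι) (f g : ι → W)
    (hfg : ∀ e ∈ E, f e ≠ g e) :
    ∃ c : W → Bool, E.card ≤ 2 * (E.filter fun e => c (f e) ≠ c (g e)).card := by
  by_contra! hc
  have key : ∀ e ∈ E, 2 * ((Finset.univ : Finset (W → Bool)).filter
      fun c => c (f e) ≠ c (g e)).card = Fintype.card (W → Bool) := by
    intro e he
    have hne := hfg e he
    have h1 := Finset.card_filter_add_card_filter_not (s := (Finset.univ : Finset (W → Bool)))
      (fun c => c (f e) ≠ c (g e))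
    have h2 : ((Finset.univ : Finset (W → Bool)).filter fun c => c (f e) ≠ c (g e)).card =
        ((Finset.univ : Finset (W → Bool)).filter fun c => ¬ c (f e) ≠ c (g e)).card := by
      refine Finset.card_bij' (fun c _ => Function.update c (f e) (!c (f e)))
        (fun c _ => Function.update c (f e) (!c (f e))) ?_ ?_ ?_ ?_
      · intro c hc
        simp only [Finset.mem_filter, Finset.mem_univ, true_and] at hc ⊢
        rw [Function.update_self, Function.update_of_ne hne.symm]
        revert hc
        cases c (f e) <;> cases c (g e) <;> simp
      · intro c hc
        simp only [Finset.mem_filter, Finset.mem_univ, true_and] at hc ⊢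
        rw [Function.update_self, Function.update_of_ne hne.symm]
        revert hc
        cases c (f e) <;> cases c (g e) <;> simp
      · intro c _; simp
      · intro c _; simp
    rw [Finset.card_univ] at h1
    omega
  have h1 : ∑ c : W → Bool, 2 * (E.filter fun e => c (f e) ≠ c (g e)).card
      = E.card * Fintype.card (W → Bool) := by
    simp_rw [← Finset.mul_sum, Finset.card_filter]
    rw [Finset.sum_comm, Finset.mul_sum, ← smul_eq_mul, ← Finset.sum_const]
    refine Finset.sum_congr rfl fun e he => ?_
    rw [← key e he, Finset.card_filter]
  have h2 : ∑ c : W → Bool, 2 * (E.filter fun e => c (f e) ≠ c (g e)).card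
      < ∑ _c : W → Bool, E.card :=
    Finset.sum_lt_sum_of_nonempty Finset.univ_nonempty fun c _ => hc c
  rw [h1, Finset.sum_const, Finset.card_univ, smul_eq_mul, mul_comm] at h2
  exact lt_irrefl _ h2

/-- A set of vertices maximising edges minus a weight of its size spans a subgraph whose minimum
degree is at least the increment of the weight. -/
lemma exists_prune [Fintype V] (G : SimpleGraph V) (w : ℕ → ℝ) :
    ∃ S : Finset V,
      ((pairs G Finset.univ Finset.univ).card : ℝ) - w (Fintype.card V)
        ≤ ((pairs G S S).card : ℝ) - w S.card ∧
      ∀ v ∈ S, w S.card - w (S.card - 1) ≤ 2 * ((pairs G {v} S).card : ℝ) := by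
  classical
  obtain ⟨S, -, hS⟩ := Finset.exists_max_image (Finset.univ : Finset (Finset V))
    (fun S => ((pairs G S S).card : ℝ) - w S.card) Finset.univ_nonempty
  refine ⟨S, by simpa using hS Finset.univ (Finset.mem_univ _), fun v hv => ?_⟩
  have h := hS (S.erase v) (Finset.mem_univ _)
  have hsub : pairs G S S ⊆ pairs G (S.erase v) (S.erase v) ∪ pairs G {v} S ∪ pairs G S {v} := by
    intro p hp
    simp only [Finset.mem_union, mem_pairs, Finset.mem_erase, Finset.mem_singleton] at hp ⊢
    tauto
  have hc := (Finset.card_le_card hsub).trans ((Finset.card_union_le _ _).trans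
    (add_le_add_left (Finset.card_union_le _ _) _))
  rw [card_pairs_comm G S {v}] at hc
  have hc' : ((pairs G S S).card : ℝ) ≤ (pairs G (S.erase v) (S.erase v)).card
      + (pairs G {v} S).card + (pairs G {v} S).card := by exact_mod_cast hc
  rw [Finset.card_erase_of_mem hv] at h
  linarith

lemma exists_path_of_minDegree (G : SimpleGraph V) (S : Finset V) (hS : S.Nonempty) (l : ℕ)
    (hd : ∀ v ∈ S, l ≤ (pairs G {v} S).card) :
    ∃ p : ℕ → V, Set.InjOn p (Set.Iic l) ∧ ∀ i < l, G.Adj (p i) (p (i + 1)) := by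
  classical
  suffices h : ∀ m ≤ l, ∃ p : ℕ → V, Set.InjOn p (Set.Iic m) ∧ (∀ i ≤ m, p i ∈ S) ∧
      ∀ i < m, G.Adj (p i) (p (i + 1)) by
    obtain ⟨p, h1, -, h2⟩ := h l le_rfl
    exact ⟨p, h1, h2⟩
  intro m
  induction m with
  | zero =>
    intro _
    obtain ⟨v, hv⟩ := hS
    refine ⟨fun _ => v, ?_, fun _ _ => hv, fun i hi => absurd hi (Nat.not_lt_zero _)⟩
    intro a ha b hb _
    simp only [Set.mem_Iic, Nat.le_zero] at ha hb
    rw [ha, hb]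
  | succ m ih =>
    intro hm
    obtain ⟨p, hinj, hpS, hadj⟩ := ih (by omega)
    -- Only `p 0, …, p (m - 1)` must be avoided, as `p m` is not its own neighbour; so degree `l`
    -- suffices for `l` edges.
    have hlt : (((Finset.range m).image p).image fun y => (p m, y)).card
        < (pairs G {p m} S).card := by
      refine lt_of_le_of_lt (Finset.card_image_le.trans Finset.card_image_le) ?_
      rw [Finset.card_range]
      exact lt_of_lt_of_le (by omega) (hd _ (hpS m le_rfl))
    obtain ⟨q, hq, hq'⟩ := Finset.exists_mem_notMem_of_card_lt_card hlt
    rw [mem_pairs, Finset.mem_singleton] at hq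
    obtain ⟨hq1, hqS, hqa⟩ := hq
    have hne : ∀ i ≤ m, p i ≠ q.2 := by
      intro i hi h
      rcases hi.lt_or_eq with hi | rfl
      · apply hq'
        rw [Finset.mem_image]
        refine ⟨q.2, Finset.mem_image.2 ⟨i, Finset.mem_range.2 hi, h⟩, ?_⟩
        rw [← hq1]
      · rw [hq1, h] at hqa
        exact G.loopless.irrefl _ hqa
    refine ⟨Function.update p (m + 1) q.2, ?_, ?_, ?_⟩
    · intro a ha b hb hab
      simp only [Set.mem_Iic] at ha hb
      rcases Nat.lt_or_eq_of_le ha with ha | rfl <;> rcases Nat.lt_or_eq_of_le hb with hb | rfl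
      · rw [Function.update_of_ne (by omega), Function.update_of_ne (by omega)] at hab
        exact hinj (Nat.lt_succ_iff.1 ha) (Nat.lt_succ_iff.1 hb) hab
      · rw [Function.update_of_ne (by omega), Function.update_self] at hab
        exact absurd hab (hne a (by omega))
      · rw [Function.update_self, Function.update_of_ne (by omega)] at hab
        exact absurd hab.symm (hne b (by omega))
      · rfl
    · intro i hi
      rcases Nat.lt_or_eq_of_le hi with hi | rfl
      · rw [Function.update_of_ne (by omega)]
        exact hpS i (by omega)
      · rw [Function.update_self]
        exact hqS
    · intro i hi
      rw [Function.update_of_ne (by omega)]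
      rcases Nat.lt_or_eq_of_le (Nat.lt_succ_iff.1 hi) with hi | rfl
      · rw [Function.update_of_ne (by omega)]
        exact hadj i hi
      · rw [Function.update_self, ← hq1]
        exact hqa

lemma exists_path_of_card_pairs [Fintype V] (G : SimpleGraph V) (l : ℕ)
    (h : 2 * l * Fintype.card V < (pairs G Finset.univ Finset.univ).card) :
    ∃ p : ℕ → V, Set.InjOn p (Set.Iic l) ∧ ∀ i < l, G.Adj (p i) (p (i + 1)) := by
  obtain ⟨S, hS, hd⟩ := exists_prune G fun s => 2 * l * s
  have h' : (2 * l * Fintype.card V : ℝ) < (pairs G Finset.univ Finset.univ).card := by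
    exact_mod_cast h
  have hne : S.Nonempty := by
    rw [Finset.nonempty_iff_ne_empty]
    rintro rfl
    simp [pairs] at hS h'
    linarith
  refine exists_path_of_minDegree G S hne l fun v hv => ?_
  have h1 := hd v hv
  have h2 : 1 ≤ S.card := hne.card_pos
  rw [Nat.cast_sub h2] at h1
  have : (l : ℝ) ≤ (pairs G {v} S).card := by
    push_cast at h1
    linarith
  exact_mod_cast this

lemma cycleGraph_isContained (G : SimpleGraph V) (k : ℕ) (hk : 3 ≤ k) (f : ℕ → V)
    (hf : Set.InjOn f (Set.Iio k)) (hadj : ∀ i, i + 1 < k → G.Adj (f i) (f (i + 1)))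
    (hlast : G.Adj (f (k - 1)) (f 0)) :
    SimpleGraph.IsContained (SimpleGraph.cycleGraph k) G := by
  have key : ∀ u v : Fin k, (v - u).val = 1 → G.Adj (f u) (f v) := by
    intro u v h
    have hu := u.2
    have hv := v.2
    rw [Fin.sub_def] at h
    simp only at h
    by_cases huv : (u : ℕ) ≤ v
    · rw [show k - (u : ℕ) + v = (v - u) + k by omega, Nat.add_mod_right,
        Nat.mod_eq_of_lt (by omega)] at h
      have := hadj u (by omega)
      rwa [show (u : ℕ) + 1 = v by omega] at this
    · rw [Nat.mod_eq_of_lt (by omega)] at h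
      rwa [show (u : ℕ) = k - 1 by omega, show (v : ℕ) = 0 by omega]
  refine ⟨⟨⟨fun i => f i, ?_⟩, ?_⟩⟩
  · intro u v h
    rw [SimpleGraph.cycleGraph_adj'] at h
    rcases h with h | h
    · exact (key v u h).symm
    · exact key u v h
  · intro u v h
    exact Fin.ext (hf u.2 v.2 h)

end Counting

end GraphFamily

namespace GraphFamily

/-! ### Edges inside the levels of a breadth-first forest -/

section BreadthFirst

variable {V : Type}

/-- A breadth-first spanning forest of `G`, given by levels and parents; a root is its own
parent. -/
structure BFSForest (G : SimpleGraph V) where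
  lev : V → ℕ
  par : V → V
  adj_par : ∀ x, lev x ≠ 0 → G.Adj x (par x)
  lev_par : ∀ x, lev (par x) = lev x - 1
  par_root : ∀ x, lev x = 0 → par x = x
  lev_le : ∀ x y, G.Adj x y → lev x ≤ lev y + 1
  root_unique : ∀ x y, G.Reachable x y → lev x = 0 → lev y = 0 → x = y

/-- Each component gets one root; a parent is the last but one vertex of a geodesic from it. The
second clause lets a diameter bound control the height. -/
lemma exists_bfsForest (G : SimpleGraph V) :
    ∃ T : BFSForest G, ∀ x, ∃ r, G.Reachable r x ∧ T.lev x = G.dist r x := by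
  classical
  let root : V → V := fun x => (G.connectedComponentMk x).out
  have hroot : ∀ x, G.Reachable (root x) x := fun x =>
    SimpleGraph.ConnectedComponent.exact (Quot.out_eq (G.connectedComponentMk x))
  have hroot' : ∀ x y, G.Reachable x y → root x = root y := by
    intro x y h
    simp only [root]
    rw [SimpleGraph.ConnectedComponent.sound h]
  have hpar : ∀ x, ∃ y, (G.dist (root x) x ≠ 0 → G.Adj x y) ∧
      G.dist (root y) y = G.dist (root x) x - 1 ∧ (G.dist (root x) x = 0 → y = x) := by
    intro x
    by_cases h0 : G.dist (root x) x = 0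
    · exact ⟨x, fun h => absurd h0 h, by omega, fun _ => rfl⟩
    obtain ⟨p, hp⟩ := (hroot x).exists_walk_length_eq_dist
    have hnil : ¬ p.Nil := by
      rw [← SimpleGraph.Walk.length_eq_zero_iff]
      omega
    have hadj : G.Adj p.penultimate x := p.adj_penultimate hnil
    have hrt : root p.penultimate = root x := hroot' _ _ hadj.reachable
    refine ⟨p.penultimate, fun _ => hadj.symm, ?_, fun h => absurd h h0⟩
    rw [hrt]
    have h1 : G.dist (root x) p.penultimate ≤ p.dropLast.length := G.dist_le p.dropLast
    have h2 : p.dropLast.length + 1 = p.length := p.length_dropLast_add_one hnil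
    have h3 : G.dist (root x) x ≤ G.dist (root x) p.penultimate + G.dist p.penultimate x :=
      SimpleGraph.Reachable.dist_triangle_right hadj.reachable _
    rw [SimpleGraph.dist_eq_one_iff_adj.2 hadj] at h3
    omega
  choose par hpar1 hpar2 hpar3 using hpar
  refine ⟨⟨fun x => G.dist (root x) x, par, hpar1, hpar2, hpar3, ?_, ?_⟩,
    fun x => ⟨root x, hroot x, rfl⟩⟩
  · intro x y h
    have h3 : G.dist (root y) x ≤ G.dist (root y) y + G.dist y x :=
      SimpleGraph.Reachable.dist_triangle_right h.symm.reachable _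
    rw [SimpleGraph.dist_eq_one_iff_adj.2 h.symm] at h3
    rwa [hroot' x y h.reachable]
  · intro x y h hx hy
    rw [(hroot x).dist_eq_zero_iff] at hx
    rw [(hroot y).dist_eq_zero_iff] at hy
    rw [← hx, ← hy, hroot' x y h]

namespace BFSForest

variable {G : SimpleGraph V} (T : BFSForest G)

lemma lev_iterate (s : ℕ) (x : V) : T.lev (T.par^[s] x) = T.lev x - s := by
  induction s with
  | zero => rfl
  | succ s ih => rw [Function.iterate_succ_apply', T.lev_par, ih]; omega

lemma reachable_iterate (s : ℕ) (x : V) : G.Reachable x (T.par^[s] x) := by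
  induction s with
  | zero => exact SimpleGraph.Reachable.refl _
  | succ s ih =>
    rw [Function.iterate_succ_apply']
    by_cases h : T.lev (T.par^[s] x) = 0
    · rwa [T.par_root _ h]
    · exact ih.trans (T.adj_par _ h).reachable

lemma adj_iterate {s : ℕ} {x : V} (h : s < T.lev x) :
    G.Adj (T.par^[s] x) (T.par^[s + 1] x) := by
  rw [Function.iterate_succ_apply']
  exact T.adj_par _ (by rw [T.lev_iterate]; omega)

lemma iterate_ne_mono {s t : ℕ} (hst : s ≤ t) {x y : V} (h : T.par^[t] x ≠ T.par^[t] y) :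
    T.par^[s] x ≠ T.par^[s] y := by
  intro h'
  apply h
  obtain ⟨d, rfl⟩ := Nat.exists_eq_add_of_le' hst
  rw [Function.iterate_add_apply, Function.iterate_add_apply, h']

/-- Both ends climb `j` edges to their common ancestor. The two branches are disjoint below it
because chains of parents never separate after meeting, and they leave the path because levels drop.
-/
lemma cycleGraph_isContained_of_path {l j lam : ℕ} (hl : 0 < l) (hj : 0 < j) (p : ℕ → V)
    (hinj : Set.InjOn p (Set.Iic l)) (hadj : ∀ i < l, G.Adj (p i) (p (i + 1)))
    (hlev : ∀ i ≤ l, T.lev (p i) = lam) (heq : T.par^[j] (p 0) = T.par^[j] (p l))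
    (hne : T.par^[j - 1] (p 0) ≠ T.par^[j - 1] (p l)) :
    SimpleGraph.IsContained (SimpleGraph.cycleGraph (l + 2 * j)) G := by
  -- Otherwise both ends have already reached the unique root of their component after `j - 1`
  -- steps.
  have hjl : j ≤ lam := by
    by_contra! hlt
    apply hne
    refine T.root_unique _ _ ?_ ?_ ?_
    · refine (T.reachable_iterate _ _).symm.trans ((T.reachable_iterate j _).trans ?_)
      rw [heq]
      exact (T.reachable_iterate j _).symm.trans (T.reachable_iterate _ _)
    · rw [T.lev_iterate, hlev 0 (by omega)]; omega
    · rw [T.lev_iterate, hlev l le_rfl]; omega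
  have h0 : T.lev (p 0) = lam := hlev 0 (by omega)
  have hl' : T.lev (p l) = lam := hlev l le_rfl
  let f : ℕ → V := fun i => if i ≤ l then p i else
    if i ≤ l + j then T.par^[i - l] (p l) else T.par^[l + 2 * j - i] (p 0)
  have f1 : ∀ i, i ≤ l → f i = p i := fun i hi => if_pos hi
  have f2 : ∀ i, l ≤ i → i ≤ l + j → f i = T.par^[i - l] (p l) := by
    intro i hi hi'
    rcases hi.eq_or_lt with rfl | hi
    · rw [f1 _ le_rfl]; simp
    · simp only [f]
      rw [if_neg (by omega), if_pos hi']
  have f3 : ∀ i, l + j ≤ i → f i = T.par^[l + 2 * j - i] (p 0) := by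
    intro i hi
    rcases hi.eq_or_lt with rfl | hi
    · rw [f2 _ (by omega) le_rfl, Nat.add_sub_cancel_left,
        show l + 2 * j - (l + j) = j by omega, heq]
    · simp only [f]
      rw [if_neg (by omega), if_neg (by omega)]
  have hwlog : ∀ a b, a < b → b < l + 2 * j → f a ≠ f b := by
    intro a b hab hb h
    rcases le_or_gt b l with hbl | hbl
    · rw [f1 a (by omega), f1 b hbl] at h
      exact hab.ne (hinj (Set.mem_Iic.2 (by omega)) (Set.mem_Iic.2 hbl) h)
    have hL := congrArg T.lev h
    rcases le_or_gt b (l + j) with hbj | hbj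
    · rw [f2 b (by omega) hbj, T.lev_iterate, hl'] at hL
      rcases le_or_gt a l with hal | hal
      · rw [f1 a hal, hlev a hal] at hL
        omega
      · rw [f2 a hal.le (by omega), T.lev_iterate, hl'] at hL
        omega
    · rw [f3 b (by omega), T.lev_iterate, h0] at hL
      rcases le_or_gt a l with hal | hal
      · rw [f1 a hal, hlev a hal] at hL
        omega
      · rcases le_or_gt a (l + j) with haj | haj
        · rw [f2 a hal.le haj, T.lev_iterate, hl'] at hL
          rw [f2 a hal.le haj, f3 b (by omega), show l + 2 * j - b = a - l by omega] at h
          exact T.iterate_ne_mono (show a - l ≤ j - 1 by omega) hne h.symm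
        · rw [f3 a (by omega), T.lev_iterate, h0] at hL
          omega
  refine cycleGraph_isContained G _ (by omega) f ?_ ?_ ?_
  · intro a ha b hb h
    rcases lt_trichotomy a b with hab | hab | hab
    · exact absurd h (hwlog a b hab hb)
    · exact hab
    · exact absurd h.symm (hwlog b a hab ha)
  · intro i hi
    rcases lt_or_ge i l with hil | hil
    · rw [f1 i hil.le, f1 (i + 1) hil]
      exact hadj i hil
    · rcases lt_or_ge i (l + j) with hij | hij
      · rw [f2 i hil hij.le, f2 (i + 1) (by omega) hij, show i + 1 - l = i - l + 1 by omega]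
        exact T.adj_iterate (by omega)
      · rw [f3 i hij, f3 (i + 1) (by omega),
          show l + 2 * j - i = l + 2 * j - (i + 1) + 1 by omega]
        exact (T.adj_iterate (by omega)).symm
  · rw [f3 _ (by omega), f1 0 (by omega), show l + 2 * j - (l + 2 * j - 1) = 0 + 1 by omega]
    exact (T.adj_iterate (by omega)).symm

open scoped Classical in
-- Colour the ancestors `j - 1` steps up and keep the edges whose ends have differently coloured
-- ones. Along kept edges the level and the `j`-th ancestor are constant and the colours alternate,
-- so a path of odd length `k - 2 * j` ends on a different branch and closes to a `C_k`.
lemma card_level_pairs_le_of_branch [Fintype V] {k j : ℕ} (hk : Odd k) (hj : 0 < j)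
    (hjk : 2 * j < k) (hfree : (SimpleGraph.cycleGraph k).Free G) :
    ((pairs G Finset.univ Finset.univ).filter fun q => T.lev q.1 = T.lev q.2 ∧
      T.par^[j] q.1 = T.par^[j] q.2 ∧ T.par^[j - 1] q.1 ≠ T.par^[j - 1] q.2).card
        ≤ 4 * k * Fintype.card V := by
  obtain ⟨c, hc⟩ := exists_cut ((pairs G Finset.univ Finset.univ).filter fun q =>
    T.lev q.1 = T.lev q.2 ∧ T.par^[j] q.1 = T.par^[j] q.2 ∧
      T.par^[j - 1] q.1 ≠ T.par^[j - 1] q.2)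
    (fun q => T.par^[j - 1] q.1) (fun q => T.par^[j - 1] q.2)
    (fun q hq => (Finset.mem_filter.1 hq).2.2.2)
  let H : SimpleGraph V :=
    { Adj := fun x y => G.Adj x y ∧ T.lev x = T.lev y ∧ T.par^[j] x = T.par^[j] y ∧
        c (T.par^[j - 1] x) ≠ c (T.par^[j - 1] y)
      symm := ⟨fun x y h => ⟨h.1.symm, h.2.1.symm, h.2.2.1.symm, h.2.2.2.symm⟩⟩
      loopless := ⟨fun x h => G.loopless.irrefl x h.1⟩ }
  have hle := Finset.card_le_card (s := Finset.filter
      (fun e : V × V => c (T.par^[j - 1] e.1) ≠ c (T.par^[j - 1] e.2))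
      ((pairs G Finset.univ Finset.univ).filter fun q =>
        T.lev q.1 = T.lev q.2 ∧ T.par^[j] q.1 = T.par^[j] q.2 ∧
        T.par^[j - 1] q.1 ≠ T.par^[j - 1] q.2)) (t := pairs H Finset.univ Finset.univ) (by
    intro q hq
    simp only [Finset.mem_filter, mem_pairs, Finset.mem_univ, true_and] at hq
    rw [mem_pairs]
    exact ⟨Finset.mem_univ _, Finset.mem_univ _, hq.1.1, hq.1.2.1, hq.1.2.2.1, hq.2⟩)
  obtain ⟨l, hlk⟩ := Nat.exists_eq_add_of_le' hjk.le
  have hlodd : Odd l := by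
    subst hlk
    exact (Nat.odd_add.1 hk).2 (even_two_mul j)
  have hH : (pairs H Finset.univ Finset.univ).card ≤ 2 * l * Fintype.card V := by
    by_contra! hgt
    obtain ⟨p, hinj, hadj⟩ := exists_path_of_card_pairs H l hgt
    apply hfree
    have hcol : ∀ i ≤ l, T.lev (p i) = T.lev (p 0) ∧ T.par^[j] (p 0) = T.par^[j] (p i) ∧
        (Odd i ↔ c (T.par^[j - 1] (p 0)) ≠ c (T.par^[j - 1] (p i))) := by
      intro i
      induction i with
      | zero => simp
      | succ i ih =>
        intro hi
        obtain ⟨a1, a2, a3⟩ := ih (by omega)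
        obtain ⟨-, b1, b2, b3⟩ := hadj i (by omega)
        refine ⟨b1.symm.trans a1, a2.trans b2, ?_⟩
        rw [Nat.odd_add_one, a3]
        revert b3
        cases c (T.par^[j - 1] (p 0)) <;> cases c (T.par^[j - 1] (p i)) <;>
          cases c (T.par^[j - 1] (p (i + 1))) <;> simp
    rw [hlk]
    refine T.cycleGraph_isContained_of_path hlodd.pos hj p hinj (fun i hi => (hadj i hi).1)
      (fun i hi => (hcol i hi).1) (hcol l le_rfl).2.1 fun h => ?_
    exact (hcol l le_rfl).2.2.1 hlodd (congrArg c h)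
  have h4 : 2 * (2 * l * Fintype.card V) ≤ 4 * k * Fintype.card V := by
    rw [hlk]
    nlinarith [Nat.zero_le (j * Fintype.card V)]
  omega

open scoped Classical in
/-- In a graph without `C_k`, few edges join two vertices on the same level of a breadth-first
forest of small height. -/
lemma card_level_pairs_le [Fintype V] {k L : ℕ} (hk : Odd k) (hL : ∀ x, T.lev x ≤ L)
    (hLk : 2 * L < k) (hfree : (SimpleGraph.cycleGraph k).Free G) :
    ((pairs G Finset.univ Finset.univ).filter fun q => T.lev q.1 = T.lev q.2).card
      ≤ L * (4 * k * Fintype.card V) := by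
  have hsub : ((pairs G Finset.univ Finset.univ).filter fun q => T.lev q.1 = T.lev q.2) ⊆
      (Finset.Icc 1 L).biUnion fun j => (pairs G Finset.univ Finset.univ).filter fun q =>
        T.lev q.1 = T.lev q.2 ∧ T.par^[j] q.1 = T.par^[j] q.2 ∧
          T.par^[j - 1] q.1 ≠ T.par^[j - 1] q.2 := by
    intro q hq
    obtain ⟨hq, hql⟩ := Finset.mem_filter.1 hq
    have hadj := (mem_pairs.1 hq).2.2
    -- On one level of one component both chains reach the root together; the least meeting height
    -- sorts the pairs.
    have hex : ∃ j, T.par^[j] q.1 = T.par^[j] q.2 := by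
      refine ⟨T.lev q.1, T.root_unique _ _ ?_ ?_ ?_⟩
      · exact (T.reachable_iterate _ _).symm.trans
          (hadj.reachable.trans (T.reachable_iterate _ _))
      · rw [T.lev_iterate, Nat.sub_self]
      · rw [T.lev_iterate, hql, Nat.sub_self]
    have hpos : Nat.find hex ≠ 0 := by
      intro h0
      have := Nat.find_spec hex
      rw [h0] at this
      exact hadj.ne this
    have hle : Nat.find hex ≤ L := by
      refine (Nat.find_min' hex (T.root_unique _ _ ?_ ?_ ?_)).trans (hL q.1)
      · exact (T.reachable_iterate _ _).symm.trans
          (hadj.reachable.trans (T.reachable_iterate _ _))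
      · rw [T.lev_iterate, Nat.sub_self]
      · rw [T.lev_iterate, hql, Nat.sub_self]
    rw [Finset.mem_biUnion]
    refine ⟨Nat.find hex, Finset.mem_Icc.2 ⟨Nat.one_le_iff_ne_zero.2 hpos, hle⟩,
      Finset.mem_filter.2 ⟨hq, hql, Nat.find_spec hex, ?_⟩⟩
    exact Nat.find_min hex (by omega)
  refine (Finset.card_le_card hsub).trans ((Finset.card_biUnion_le_card_mul _ _
    (4 * k * Fintype.card V) ?_).trans ?_)
  · intro j hj
    rw [Finset.mem_Icc] at hj
    exact T.card_level_pairs_le_of_branch hk (by omega) (by omega) hfree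
  · rw [Nat.card_Icc, Nat.add_sub_cancel]

end BFSForest

end BreadthFirst

end GraphFamily

namespace GraphFamily

/-! ### Expansion and bounded diameter -/

section Expansion

variable {V : Type}

lemma zz_bddAbove (m n : ℕ) (F : GraphFamily) :
    BddAbove {e | ∃ G : SimpleGraph (Fin m ⊕ Fin n),
      G ≤ completeBipartiteGraph (Fin m) (Fin n) ∧ F.IsFree G ∧ numEdges G = e} := by
  refine ⟨numEdges (⊤ : SimpleGraph (Fin m ⊕ Fin n)), ?_⟩
  rintro e ⟨G, -, -, rfl⟩
  exact numEdges_mono le_top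

lemma card_pairs_le_zz {F : GraphFamily} {G : SimpleGraph V} (hG : F.IsFree G)
    {A B : Finset V} (hAB : Disjoint A B) : (pairs G A B).card ≤ zz A.card B.card F := by
  classical
  let f : Fin A.card ⊕ Fin B.card → V :=
    Sum.elim (fun i => (A.equivFin.symm i : V)) (fun j => (B.equivFin.symm j : V))
  have hf : Function.Injective f := by
    refine Function.Injective.sumElim (Subtype.val_injective.comp A.equivFin.symm.injective)
      (Subtype.val_injective.comp B.equivFin.symm.injective) ?_
    intro i j h
    exact Finset.disjoint_left.1 hAB (A.equivFin.symm i).2 (h ▸ (B.equivFin.symm j).2)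
  let H : SimpleGraph (Fin A.card ⊕ Fin B.card) :=
    G.comap f ⊓ completeBipartiteGraph (Fin A.card) (Fin B.card)
  have hH : SimpleGraph.IsContained H G :=
    ⟨⟨⟨f, fun {a b} h => h.1⟩, hf⟩⟩
  have hle : numEdges H ≤ zz A.card B.card F :=
    le_csSup (zz_bddAbove _ _ _) ⟨H, inf_le_right, hG.of_isContained hH, rfl⟩
  refine le_trans ?_ hle
  let Q : Finset (Fin A.card × Fin B.card) :=
    Finset.univ.filter fun q => G.Adj (f (Sum.inl q.1)) (f (Sum.inr q.2))
  have hQ : pairs G A B ⊆ Q.image fun q => (f (Sum.inl q.1), f (Sum.inr q.2)) := by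
    rintro ⟨x, y⟩ h
    rw [mem_pairs] at h
    obtain ⟨hx, hy, hxy⟩ := h
    have e1 : f (Sum.inl (A.equivFin ⟨x, hx⟩)) = x := by simp [f]
    have e2 : f (Sum.inr (B.equivFin ⟨y, hy⟩)) = y := by simp [f]
    rw [Finset.mem_image]
    refine ⟨(A.equivFin ⟨x, hx⟩, B.equivFin ⟨y, hy⟩), ?_, by rw [e1, e2]⟩
    simp only [Q, Finset.mem_filter, Finset.mem_univ, true_and]
    rwa [e1, e2]
  refine ((Finset.card_le_card hQ).trans Finset.card_image_le).trans ?_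
  rw [← Set.ncard_coe_finset]
  refine Set.ncard_le_ncard_of_injOn (fun q => s(Sum.inl q.1, Sum.inr q.2)) ?_ ?_
    (Set.toFinite _)
  · intro q hq
    simp only [Q, Finset.coe_filter, Finset.mem_univ, true_and, Set.mem_ofPred_eq] at hq
    rw [SimpleGraph.mem_edgeSet]
    exact ⟨hq, by simp⟩
  · rintro ⟨a, b⟩ - ⟨a', b'⟩ - h
    simpa using h

variable {F : GraphFamily} {α β ρ C : ℝ}

lemma card_pairs_le_of_card_le (hβ : 0 ≤ β) (hα : 1 ≤ α) (hρ : 0 ≤ ρ) (hC : 0 ≤ C)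
    (hz : ∀ m n : ℕ, m ≤ n → (zz m n F : ℝ) ≤ ρ * m * (n : ℝ) ^ (α - 1) + C * (n : ℝ) ^ β)
    {G : SimpleGraph V} (hG : F.IsFree G) {A B : Finset V} (hAB : Disjoint A B) {a b : ℕ}
    (ha : A.card ≤ a) (hb : B.card ≤ b) (hab : a ≤ b) :
    ((pairs G A B).card : ℝ) ≤ ρ * a * (b : ℝ) ^ (α - 1) + C * (b : ℝ) ^ β := by
  have key : ∀ s t : ℕ, s ≤ t → s ≤ a → t ≤ b →
      (zz s t F : ℝ) ≤ ρ * a * (b : ℝ) ^ (α - 1) + C * (b : ℝ) ^ β := by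
    intro s t hst hs ht
    refine (hz s t hst).trans ?_
    have h1 : (t : ℝ) ^ (α - 1) ≤ (b : ℝ) ^ (α - 1) :=
      Real.rpow_le_rpow (by positivity) (by exact_mod_cast ht) (by linarith)
    have h2 : (t : ℝ) ^ β ≤ (b : ℝ) ^ β :=
      Real.rpow_le_rpow (by positivity) (by exact_mod_cast ht) hβ
    have h3 : (s : ℝ) ≤ a := by exact_mod_cast hs
    gcongr
  rcases le_total A.card B.card with h | h
  · exact (Nat.cast_le.2 (card_pairs_le_zz hG hAB)).trans (key _ _ h ha hb)
  -- If `A` is the larger set the roles swap: `B.card ≤ A.card ≤ a` and `A.card ≤ a ≤ b`.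
  · rw [card_pairs_comm]
    exact (Nat.cast_le.2 (card_pairs_le_zz hG hAB.symm)).trans
      (key _ _ h (h.trans ha) (ha.trans hab))

/-- Sum the degrees over `A`. Since `A` and `B` overlap, pass to a cut: a factor 2 for the cut and
another for its two orientations. -/
lemma mul_card_le_of_neighbors_mem (hβ : 0 ≤ β) (hα : 1 ≤ α) (hρ : 0 ≤ ρ) (hC : 0 ≤ C)
    (hz : ∀ m n : ℕ, m ≤ n → (zz m n F : ℝ) ≤ ρ * m * (n : ℝ) ^ (α - 1) + C * (n : ℝ) ^ β)
    [Fintype V] {G : SimpleGraph V} (hG : F.IsFree G) {A B : Finset V} (hAB : A ⊆ B) {D : ℝ}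
    (hD : ∀ v ∈ A, D ≤ ((pairs G {v} B).card : ℝ)) :
    D * A.card ≤ 4 * (ρ * A.card * (B.card : ℝ) ^ (α - 1) + C * (B.card : ℝ) ^ β) := by
  classical
  have hsum : D * A.card ≤ ((pairs G A B).card : ℝ) := by
    have h1 : pairs G A B = A.biUnion fun v => pairs G {v} B := by
      ext p
      simp [mem_pairs]
    rw [h1, Finset.card_biUnion, Nat.cast_sum, mul_comm, ← nsmul_eq_mul]
    · exact Finset.card_nsmul_le_sum _ _ _ hD
    · intro x _ y _ hxy
      rw [Function.onFun, Finset.disjoint_left]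
      intro p hp hq
      rw [mem_pairs, Finset.mem_singleton] at hp hq
      exact hxy (hp.1.symm.trans hq.1)
  obtain ⟨c, hc⟩ := exists_cut (pairs G A B) Prod.fst Prod.snd
    (fun p hp => (mem_pairs.1 hp).2.2.ne)
  have hsub : ((pairs G A B).filter fun e => c e.1 ≠ c e.2) ⊆
      pairs G (A.filter fun x => c x = true) (B.filter fun x => c x = false) ∪
      pairs G (A.filter fun x => c x = false) (B.filter fun x => c x = true) := by
    intro p hp
    simp only [Finset.mem_filter, mem_pairs, Finset.mem_union] at hp ⊢
    obtain ⟨⟨h1, h2, h3⟩, h4⟩ := hp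
    revert h4
    cases c p.1 <;> cases c p.2 <;> simp [h1, h2, h3]
  have hdis : ∀ b : Bool, Disjoint (A.filter fun x => c x = b) (B.filter fun x => c x = !b) := by
    intro b
    rw [Finset.disjoint_left]
    intro x hx hy
    rw [Finset.mem_filter] at hx hy
    rw [hx.2] at hy
    simp at hy
  have h1 := card_pairs_le_of_card_le hβ hα hρ hC hz hG (hdis true)
    (Finset.card_filter_le _ _) (Finset.card_filter_le _ _) (Finset.card_le_card hAB)
  have h2 := card_pairs_le_of_card_le hβ hα hρ hC hz hG (hdis false)
    (Finset.card_filter_le _ _) (Finset.card_filter_le _ _) (Finset.card_le_card hAB)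
  have h3 := (Finset.card_le_card hsub).trans (Finset.card_union_le _ _)
  have h4 : ((pairs G A B).card : ℝ) ≤ 2 * ((pairs G A B).filter fun e => c e.1 ≠ c e.2).card := by
    exact_mod_cast hc
  have h5 : (((pairs G A B).filter fun e => c e.1 ≠ c e.2).card : ℝ) ≤
      (pairs G (A.filter fun x => c x = true) (B.filter fun x => c x = false)).card +
      (pairs G (A.filter fun x => c x = false) (B.filter fun x => c x = true)).card := by
    exact_mod_cast h3
  simp only [Bool.not_true, Bool.not_false] at h1 h2
  linarith

/-- Split by the larger of the two terms on the right: the density term makes `b` linear in `n`,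
while the error term, with `b ^ β ≤ b * n ^ (β - 1)`, forces growth. -/
lemma linear_or_growth (hβ : 1 ≤ β) (hα : 1 < α) (hρ : 0 < ρ) (hC : 0 < C) {c : ℝ} (hc : 0 < c)
    {a b n : ℝ} (ha : 0 < a) (hb : 0 < b) (hbn : b ≤ n)
    (h : c * n ^ (α - 1) * a ≤ 4 * (ρ * a * b ^ (α - 1) + C * b ^ β)) :
    (c / (8 * ρ)) ^ (1 / (α - 1)) * n ≤ b ∨ c / (8 * C) * n ^ (α - β) * a ≤ b := by
  have hn : 0 < n := hb.trans_le hbn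
  rcases le_total (ρ * a * b ^ (α - 1)) (C * b ^ β) with h1 | h1
  · right
    have h2 : b ^ β ≤ b * n ^ (β - 1) := by
      calc b ^ β = b * b ^ (β - 1) := by
            rw [← Real.rpow_one_add' hb.le (by linarith)]; congr 1; ring
        _ ≤ b * n ^ (β - 1) := by
            gcongr
    have h3 : n ^ (α - 1) = n ^ (α - β) * n ^ (β - 1) := by
      rw [← Real.rpow_add hn]; congr 1; ring
    have h4 : 0 < n ^ (β - 1) := Real.rpow_pos_of_pos hn _
    have h5 : c * n ^ (α - β) * a * n ^ (β - 1) ≤ 8 * C * b * n ^ (β - 1) := by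
      rw [h3] at h
      nlinarith
    have h6 := le_of_mul_le_mul_right h5 h4
    rw [show c / (8 * C) * n ^ (α - β) * a = (c * n ^ (α - β) * a) / (8 * C) by ring,
      div_le_iff₀ (by positivity)]
    linarith
  · left
    have h2 : c * n ^ (α - 1) ≤ 8 * ρ * b ^ (α - 1) := by
      refine le_of_mul_le_mul_right ?_ ha
      linarith
    have hα' : 0 < α - 1 := by linarith
    rw [← Real.rpow_le_rpow_iff (by positivity) hb.le hα', Real.mul_rpow (by positivity) hn.le,
      ← Real.rpow_mul (by positivity), one_div_mul_cancel hα'.ne', Real.rpow_one, div_mul_eq_mul_div,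
      div_le_iff₀ (by positivity)]
    linarith

open scoped Classical in
/-- The set of vertices at distance at most `r` from `v`. -/
noncomputable def closedBall [Fintype V] (G : SimpleGraph V) (v : V) (r : ℕ) : Finset V :=
  Finset.univ.filter fun x => G.Reachable v x ∧ G.dist v x ≤ r

lemma mem_closedBall [Fintype V] {G : SimpleGraph V} {v x : V} {r : ℕ} :
    x ∈ closedBall G v r ↔ G.Reachable v x ∧ G.dist v x ≤ r := by
  simp [closedBall]

/-- Balls of radius `r` centred `2 * r + 1` apart along a geodesic are disjoint, so at most `1 / c`
of them fit. -/
lemma dist_mul_le_of_le_card_closedBall [Fintype V] {G : SimpleGraph V} {c : ℝ} {r : ℕ}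
    (h : ∀ v, c * Fintype.card V ≤ ((closedBall G v r).card : ℝ)) {v w : V}
    (hvw : G.Reachable v w) : (G.dist v w : ℝ) * c ≤ 2 * r + 1 := by
  classical
  rcases le_or_gt c 0 with hc | hc
  · have : (G.dist v w : ℝ) * c ≤ 0 := mul_nonpos_of_nonneg_of_nonpos (by positivity) hc
    have : (0 : ℝ) ≤ r := by positivity
    linarith
  obtain ⟨p, hp⟩ := hvw.exists_walk_length_eq_dist
  let J := G.dist v w / (2 * r + 1)
  have hx : ∀ t ≤ G.dist v w, G.Reachable v (p.getVert t) ∧ G.dist v (p.getVert t) = t := by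
    intro t ht
    have h1 : G.Reachable v (p.getVert t) := (p.take t).reachable
    have h2 : G.dist v (p.getVert t) ≤ (p.take t).length := G.dist_le _
    have h3 : G.dist (p.getVert t) w ≤ (p.drop t).length := G.dist_le _
    have h4 : G.dist v w ≤ G.dist v (p.getVert t) + G.dist (p.getVert t) w :=
      h1.dist_triangle_left _
    rw [SimpleGraph.Walk.take_length] at h2
    rw [SimpleGraph.Walk.drop_length] at h3
    exact ⟨h1, by omega⟩
  have hJ : ∀ s ∈ Finset.range (J + 1), (2 * r + 1) * s ≤ G.dist v w := by
    intro s hs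
    rw [Finset.mem_range, Nat.lt_succ_iff, Nat.le_div_iff_mul_le (by omega)] at hs
    linarith
  have hdisj : ((Finset.range (J + 1) : Finset ℕ) : Set ℕ).PairwiseDisjoint
      fun s => closedBall G (p.getVert ((2 * r + 1) * s)) r := by
    intro s hs t ht hst
    rw [Function.onFun, Finset.disjoint_left]
    intro y hy hy'
    rw [mem_closedBall] at hy hy'
    obtain ⟨s1, s2⟩ := hx _ (hJ s hs)
    obtain ⟨t1, t2⟩ := hx _ (hJ t ht)
    have b1 := s1.dist_triangle_left y
    have b2 := hy.1.symm.dist_triangle_right v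
    have b3 := t1.dist_triangle_left y
    have b4 := hy'.1.symm.dist_triangle_right v
    rw [G.dist_comm (u := y)] at b2 b4
    rcases Nat.lt_or_gt_of_ne hst with hlt | hlt
    · nlinarith
    · nlinarith
  have hcard : ((J + 1 : ℕ) : ℝ) * (c * Fintype.card V) ≤ Fintype.card V := by
    have h1 : ∑ s ∈ Finset.range (J + 1),
        (closedBall G (p.getVert ((2 * r + 1) * s)) r).card ≤ Fintype.card V := by
      rw [← Finset.card_biUnion hdisj]
      exact Finset.card_le_univ _
    have h2 : (Finset.range (J + 1)).card • (c * Fintype.card V) ≤ ∑ s ∈ Finset.range (J + 1),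
        ((closedBall G (p.getVert ((2 * r + 1) * s)) r).card : ℝ) :=
      Finset.card_nsmul_le_sum _ _ _ fun s _ => h _
    rw [Finset.card_range, nsmul_eq_mul] at h2
    refine h2.trans ?_
    exact_mod_cast h1
  have hV : (0 : ℝ) < Fintype.card V := by
    have : Nonempty V := ⟨v⟩
    exact_mod_cast Fintype.card_pos
  have hJc : ((J + 1 : ℕ) : ℝ) * c ≤ 1 := by
    refine le_of_mul_le_mul_right ?_ hV
    linarith
  have hlt : G.dist v w < (2 * r + 1) * (J + 1) := by
    have := Nat.div_add_mod (G.dist v w) (2 * r + 1)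
    have := Nat.mod_lt (G.dist v w) (show 0 < 2 * r + 1 by omega)
    simp only [J]
    linarith
  have hlt' : (G.dist v w : ℝ) ≤ (2 * r + 1) * ((J + 1 : ℕ) : ℝ) := by exact_mod_cast hlt.le
  nlinarith

/-- Dense `F`-free graphs of large minimum degree have components of bounded diameter. -/
lemma exists_dist_le (hβ : 1 ≤ β) (hβα : β < α) (hρ : 0 < ρ) (hC : 0 < C)
    (hz : ∀ m n : ℕ, m ≤ n → (zz m n F : ℝ) ≤ ρ * m * (n : ℝ) ^ (α - 1) + C * (n : ℝ) ^ β)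
    {c : ℝ} (hc : 0 < c) :
    ∃ N L : ℕ, ∀ (V : Type) [Fintype V] (G : SimpleGraph V), F.IsFree G → N ≤ Fintype.card V →
      (∀ v, c * (Fintype.card V : ℝ) ^ (α - 1) ≤ ((pairs G {v} Finset.univ).card : ℝ)) →
      ∀ v w, G.Reachable v w → G.dist v w ≤ L := by
  let c₁ : ℝ := min ((c / (8 * ρ)) ^ (1 / (α - 1))) 1
  have hc₁ : 0 < c₁ := lt_min (by positivity) one_pos
  let δ := α - β
  have hδ : 0 < δ := sub_pos.2 hβα
  -- Half of the exponent `δ` absorbs the constant `8 * C / c`; the other half is the gain per step,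
  -- so `2 / δ` steps reach size `n`.
  obtain ⟨r, hr⟩ := exists_nat_ge (2 / δ)
  have hev : ∀ᶠ n : ℕ in atTop, (8 * C / c) ≤ (n : ℝ) ^ (δ / 2) :=
    ((tendsto_rpow_atTop (half_pos hδ)).comp tendsto_natCast_atTop_atTop).eventually_ge_atTop _
  obtain ⟨N, hN⟩ := eventually_atTop.1 hev
  obtain ⟨L, hL⟩ := exists_nat_ge ((2 * r + 1) / c₁)
  refine ⟨N, L, ?_⟩
  intro V _ G hG hn hdeg v w hvw
  set n : ℕ := Fintype.card V with hndef
  have hn1 : (1 : ℝ) ≤ n := by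
    have : Nonempty V := ⟨v⟩
    exact_mod_cast Fintype.card_pos
  have hn0 : (0 : ℝ) < n := by linarith
  have hball : ∀ v, c₁ * n ≤ ((closedBall G v r).card : ℝ) := by
    intro v
    have key : ∀ i : ℕ, c₁ * n ≤ ((closedBall G v i).card : ℝ) ∨
        (n : ℝ) ^ (δ / 2 * i) ≤ ((closedBall G v i).card : ℝ) := by
      intro i
      induction i with
      | zero =>
        right
        have h0 : v ∈ closedBall G v 0 := by
          rw [mem_closedBall]
          exact ⟨SimpleGraph.Reachable.refl _, by simp⟩
        have : 1 ≤ (closedBall G v 0).card := Finset.card_pos.2 ⟨v, h0⟩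
        simpa using this
      | succ i ih =>
        have hsub : closedBall G v i ⊆ closedBall G v (i + 1) := by
          intro x hx
          rw [mem_closedBall] at hx ⊢
          exact ⟨hx.1, by omega⟩
        have hcard : ((closedBall G v i).card : ℝ) ≤ (closedBall G v (i + 1)).card := by
          exact_mod_cast Finset.card_le_card hsub
        rcases ih with ih | ih
        · exact Or.inl (ih.trans hcard)
        have hapos : (0 : ℝ) < (closedBall G v i).card :=
          (Real.rpow_pos_of_pos hn0 _).trans_le ih
        have hmul := mul_card_le_of_neighbors_mem (by linarith) (by linarith) hρ.le hC.le hz hG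
          hsub (D := c * (n : ℝ) ^ (α - 1)) (by
            intro x hx
            refine (hdeg x).trans ?_
            rw [Nat.cast_le]
            refine Finset.card_le_card ?_
            intro p hp
            rw [mem_pairs, Finset.mem_singleton] at hp ⊢
            refine ⟨hp.1, ?_, hp.2.2⟩
            rw [mem_closedBall] at hx ⊢
            have hadj : G.Adj x p.2 := hp.1 ▸ hp.2.2
            refine ⟨hx.1.trans hadj.reachable, ?_⟩
            have h1 := hx.1.dist_triangle_left p.2
            rw [SimpleGraph.dist_eq_one_iff_adj.2 hadj] at h1
            omega)
        rcases linear_or_growth hβ (by linarith) hρ hC hc hapos (hapos.trans_le hcard)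
          (n := n) (by exact_mod_cast Finset.card_le_univ _) hmul with h | h
        · left
          refine le_trans ?_ h
          gcongr
          exact min_le_left _ _
        · right
          refine le_trans ?_ h
          have h1 : (n : ℝ) ^ (α - β) = (n : ℝ) ^ (δ / 2) * (n : ℝ) ^ (δ / 2) := by
            rw [← Real.rpow_add hn0]; congr 1; simp only [δ]; ring
          have h2 : (n : ℝ) ^ (δ / 2 * ((i + 1 : ℕ) : ℝ)) =
              (n : ℝ) ^ (δ / 2) * (n : ℝ) ^ (δ / 2 * i) := by
            rw [← Real.rpow_add hn0]; congr 1; push_cast; ring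
          have h3 : 1 ≤ c / (8 * C) * (n : ℝ) ^ (δ / 2) := by
            have := hN n hn
            rw [div_le_iff₀ hc] at this
            rw [div_mul_eq_mul_div, le_div_iff₀ (by positivity)]
            linarith
          rw [h1, h2]
          calc (n : ℝ) ^ (δ / 2) * (n : ℝ) ^ (δ / 2 * i)
              ≤ (n : ℝ) ^ (δ / 2) * (closedBall G v i).card := by gcongr
            _ ≤ (c / (8 * C) * (n : ℝ) ^ (δ / 2)) *
                ((n : ℝ) ^ (δ / 2) * (closedBall G v i).card) :=
                  le_mul_of_one_le_left (by positivity) h3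
            _ = _ := by ring
    rcases key r with h | h
    · exact h
    · refine le_trans ?_ h
      have h1 : (1 : ℝ) ≤ δ / 2 * r := by
        rw [div_le_iff₀ hδ] at hr
        linarith
      calc c₁ * n ≤ 1 * n := by gcongr; exact min_le_right _ _
        _ = (n : ℝ) ^ (1 : ℝ) := by rw [one_mul, Real.rpow_one]
        _ ≤ _ := Real.rpow_le_rpow_of_exponent_le hn1 h1
  have h1 := dist_mul_le_of_le_card_closedBall hball hvw
  have h2 : (G.dist v w : ℝ) ≤ L := by
    refine le_trans ?_ hL
    rwa [le_div_iff₀ hc₁]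
  exact_mod_cast h2

end Expansion

end GraphFamily

namespace GraphFamily

/-! ### Decomposition into a bipartite graph and a sparse remainder -/

section Structure

variable {V : Type} {F : GraphFamily} {α β ρ C : ℝ}

/-- The leading term `ρ (s / 2) ^ α` of the number of edges of an extremal bipartite graph on `s`
vertices. -/
noncomputable def mainTerm (ρ α : ℝ) (s : ℝ) : ℝ := ρ * (s / 2) ^ α

/-- Write the left side as `a ^ (2 - α) * (a * b) ^ (α - 1)`; then bound `a` by the mean and `a * b`
by AM-GM. So balanced parts are optimal. -/
lemma mul_rpow_le_half_rpow (hα : 1 < α) (hα2 : α < 2) {a b : ℝ} (ha : 0 ≤ a) (hab : a ≤ b) :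
    a * b ^ (α - 1) ≤ ((a + b) / 2) ^ α := by
  rcases ha.eq_or_lt with rfl | ha
  · rw [zero_mul]; positivity
  have hb : 0 < b := ha.trans_le hab
  have hs : 0 < (a + b) / 2 := by positivity
  have h1 : a = a ^ (2 - α) * a ^ (α - 1) := by
    rw [← Real.rpow_add ha, show 2 - α + (α - 1) = 1 by ring, Real.rpow_one]
  have h2 : a ^ (2 - α) ≤ ((a + b) / 2) ^ (2 - α) :=
    Real.rpow_le_rpow ha.le (by linarith) (by linarith)
  have h3 : (a * b) ^ (α - 1) ≤ (((a + b) / 2) * ((a + b) / 2)) ^ (α - 1) :=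
    Real.rpow_le_rpow (by positivity) (by nlinarith [sq_nonneg (a - b)]) (by linarith)
  calc a * b ^ (α - 1) = a ^ (2 - α) * (a * b) ^ (α - 1) := by
        rw [Real.mul_rpow ha.le hb.le, ← mul_assoc, ← h1]
    _ ≤ ((a + b) / 2) ^ (2 - α) * (((a + b) / 2) * ((a + b) / 2)) ^ (α - 1) := by gcongr
    _ = ((a + b) / 2) ^ α := by
        rw [Real.mul_rpow hs.le hs.le, ← Real.rpow_add hs, ← Real.rpow_add hs]
        congr 1
        ring

lemma mainTerm_increment (hα : 1 < α) (hρ : 0 ≤ ρ) {s : ℝ} (hs : 1 ≤ s) :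
    ρ / 2 ^ α * s ^ (α - 1) ≤ mainTerm ρ α s - mainTerm ρ α (s - 1) := by
  have h0 : 0 < s := by linarith
  have h1 : s ^ α = s * s ^ (α - 1) := by
    rw [← Real.rpow_one_add' h0.le (by linarith)]; congr 1; ring
  have h2 : (s - 1) ^ α = (s - 1) * (s - 1) ^ (α - 1) := by
    rw [← Real.rpow_one_add' (by linarith) (by linarith)]; congr 1; ring
  have h3 : (s - 1) ^ (α - 1) ≤ s ^ (α - 1) :=
    Real.rpow_le_rpow (by linarith) (by linarith) (by linarith)
  have h4 : s ^ (α - 1) ≤ s ^ α - (s - 1) ^ α := by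
    rw [h1, h2]
    nlinarith
  rw [mainTerm, mainTerm, Real.div_rpow h0.le (by norm_num),
    Real.div_rpow (by linarith) (by norm_num)]
  calc ρ / 2 ^ α * s ^ (α - 1) ≤ ρ / 2 ^ α * (s ^ α - (s - 1) ^ α) := by gcongr
    _ = _ := by ring

lemma card_pairs_le_mainTerm (hβ : 0 ≤ β) (hα : 1 < α) (hα2 : α < 2) (hρ : 0 ≤ ρ) (hC : 0 ≤ C)
    (hz : ∀ m n : ℕ, m ≤ n → (zz m n F : ℝ) ≤ ρ * m * (n : ℝ) ^ (α - 1) + C * (n : ℝ) ^ β)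
    {G : SimpleGraph V} (hG : F.IsFree G) {A B : Finset V} (hAB : Disjoint A B) :
    ((pairs G A B).card : ℝ) ≤
      mainTerm ρ α ((A.card + B.card : ℕ) : ℝ) + C * ((A.card + B.card : ℕ) : ℝ) ^ β := by
  wlog h : A.card ≤ B.card generalizing A B
  · rw [card_pairs_comm, add_comm A.card]
    exact this hAB.symm (le_of_not_ge h)
  refine (card_pairs_le_of_card_le hβ hα.le hρ hC hz hG hAB le_rfl le_rfl h).trans ?_
  have h1 := mul_rpow_le_half_rpow hα hα2 (Nat.cast_nonneg A.card) (Nat.cast_le (α := ℝ).2 h)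
  have h2 : (B.card : ℝ) ^ β ≤ ((A.card + B.card : ℕ) : ℝ) ^ β :=
    Real.rpow_le_rpow (by positivity) (by exact_mod_cast Nat.le_add_left _ _) hβ
  rw [mainTerm, mul_assoc]
  push_cast at h2 ⊢
  gcongr

open scoped Classical in
-- Colour by parity of level: levels of neighbours differ by at most one, so equal parity means
-- equal level. `N` and `L` are chosen before `k`.
lemma exists_coloring (hβ : 1 ≤ β) (hβα : β < α) (hρ : 0 < ρ) (hC : 0 < C)
    (hz : ∀ m n : ℕ, m ≤ n → (zz m n F : ℝ) ≤ ρ * m * (n : ℝ) ^ (α - 1) + C * (n : ℝ) ^ β)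
    {c : ℝ} (hc : 0 < c) :
    ∃ N L : ℕ, ∀ k : ℕ, Odd k → 2 * L < k → ∀ (V : Type) [Fintype V] (G : SimpleGraph V),
      F.IsFree G → (SimpleGraph.cycleGraph k).Free G → N ≤ Fintype.card V →
      (∀ v, c * (Fintype.card V : ℝ) ^ (α - 1) ≤ ((pairs G {v} Finset.univ).card : ℝ)) →
      ∃ χ : V → Bool, ((pairs G Finset.univ Finset.univ).filter
        fun q => χ q.1 = χ q.2).card ≤ L * (4 * k * Fintype.card V) := by
  obtain ⟨N, L, hNL⟩ := exists_dist_le hβ hβα hρ hC hz hc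
  refine ⟨N, L, fun k hk hLk V _ G hG hfree hn hdeg => ?_⟩
  obtain ⟨T, hT⟩ := exists_bfsForest G
  refine ⟨fun x => decide (Even (T.lev x)), ?_⟩
  refine (Finset.card_le_card ?_).trans (T.card_level_pairs_le hk (L := L) ?_ hLk hfree)
  · intro q hq
    simp only [Finset.mem_filter, decide_eq_decide] at hq ⊢
    refine ⟨hq.1, ?_⟩
    have hadj := (mem_pairs.1 hq.1).2.2
    have h1 := T.lev_le _ _ hadj
    have h2 := T.lev_le _ _ hadj.symm
    have h3 := hq.2
    rw [Nat.even_iff, Nat.even_iff] at h3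
    omega
  · intro x
    obtain ⟨r, hr, hx⟩ := hT x
    rw [hx]
    exact hNL V G hG hn hdeg r x hr

/-- Up to lower-order terms, a graph without members of `F` and without `C_k` consists of a
bipartite graph on `s` vertices and a remainder with few edges. -/
lemma exists_bipartite_subgraph (hβ : 1 ≤ β) (hβα : β < α) (hα2 : α < 2) (hρ : 0 < ρ) (hC : 0 < C)
    (hz : ∀ m n : ℕ, m ≤ n → (zz m n F : ℝ) ≤ ρ * m * (n : ℝ) ^ (α - 1) + C * (n : ℝ) ^ β) :
    ∃ k₀ : ℕ, ∀ k : ℕ, k₀ ≤ k → Odd k → ∃ K : ℝ, 0 ≤ K ∧ ∀ (V : Type) [Fintype V] [Nonempty V]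
      (G : SimpleGraph V), F.IsFree G → (SimpleGraph.cycleGraph k).Free G →
      ∃ (s : ℝ) (H : SimpleGraph V), H ≤ G ∧ H.IsBipartite ∧
        mainTerm ρ α s ≤ mainTerm ρ α (Fintype.card V) ∧
        (numEdges G : ℝ) ≤ numEdges H +
          (mainTerm ρ α (Fintype.card V) - mainTerm ρ α s) / 2 + K * (Fintype.card V : ℝ) ^ β ∧
        (numEdges H : ℝ) ≤ mainTerm ρ α s + K * (Fintype.card V : ℝ) ^ β := by
  classical
  have hα : 1 < α := by linarith
  -- Pruning bounds twice the degree by the increment of `mainTerm`, hence the final `/ 2`.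
  obtain ⟨N, L, hNL⟩ := exists_coloring hβ hβα hρ hC hz (c := ρ / 2 ^ α / 2) (by positivity)
  refine ⟨2 * L + 1, fun k hLk hk => ⟨N * N + L * (4 * k) + C, by positivity, ?_⟩⟩
  intro V _ _ G hG hfree
  have hn1 : (1 : ℝ) ≤ Fintype.card V := by exact_mod_cast Fintype.card_pos
  have hnβ : (1 : ℝ) ≤ (Fintype.card V : ℝ) ^ β := Real.one_le_rpow hn1 (by linarith)
  have hnβ' : (Fintype.card V : ℝ) ≤ (Fintype.card V : ℝ) ^ β := by
    simpa using Real.rpow_le_rpow_of_exponent_le hn1 hβ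
  -- The weight is set against ordered pairs, which is the source of the factor 1/2 in the
  -- conclusion.
  obtain ⟨S, hS, hdeg⟩ := exists_prune G fun s => mainTerm ρ α s
  have hpG : ((pairs G Finset.univ Finset.univ).card : ℝ) = 2 * numEdges G := by
    exact_mod_cast card_pairs_univ G
  rw [hpG] at hS
  have hSn : (S.card : ℝ) ≤ Fintype.card V := by exact_mod_cast Finset.card_le_univ S
  have hSw : mainTerm ρ α S.card ≤ mainTerm ρ α (Fintype.card V) := by
    rw [mainTerm, mainTerm]
    gcongr
  have hK1 : (0 : ℝ) ≤ N * N * ((Fintype.card V : ℝ) ^ β - 1) :=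
    mul_nonneg (by positivity) (by linarith)
  have hK2 : (L * (4 * k) : ℝ) * S.card ≤ L * (4 * k) * (Fintype.card V : ℝ) ^ β := by
    gcongr
    linarith
  have hK2' : (0 : ℝ) ≤ L * (4 * k) * (Fintype.card V : ℝ) ^ β := by positivity
  have hK3 : 0 ≤ C * (Fintype.card V : ℝ) ^ β := by positivity
  rcases lt_or_ge S.card N with hSN | hSN
  · refine ⟨S.card, ⊥, bot_le, ⟨⟨fun _ => 0, fun h => absurd h id⟩⟩, hSw, ?_, ?_⟩
    · have h1 : (pairs G S S).card ≤ N * N := by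
        refine (Finset.card_filter_le _ _).trans ?_
        rw [Finset.card_product]
        exact Nat.mul_le_mul hSN.le hSN.le
      have h1' : ((pairs G S S).card : ℝ) ≤ N * N := by exact_mod_cast h1
      have h2 : numEdges (⊥ : SimpleGraph V) = 0 := by simp [numEdges]
      have h3 : (0 : ℝ) ≤ (N : ℝ) * N := by positivity
      rw [h2]
      push_cast
      linarith
    · have h2 : numEdges (⊥ : SimpleGraph V) = 0 := by simp [numEdges]
      have h4 : 0 ≤ mainTerm ρ α (S.card : ℝ) := by rw [mainTerm]; positivity
      rw [h2]
      push_cast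
      positivity
  · let i : S → V := Subtype.val
    have hcont : SimpleGraph.IsContained (G.comap i) G :=
      ⟨⟨⟨i, fun {a b} h => h⟩, Subtype.val_injective⟩⟩
    have hcardS : Fintype.card S = S.card := Fintype.card_coe S
    obtain ⟨χ, hχ⟩ := hNL k hk (by omega) S (G.comap i) (hG.of_isContained hcont)
      (fun h => hfree (h.trans hcont)) (by rwa [hcardS]) (by
        rintro ⟨v, hv⟩
        have h1 : (1 : ℝ) ≤ S.card := by
          exact_mod_cast Finset.card_pos.2 ⟨v, hv⟩
        have h2 := hdeg v hv
        rw [Nat.cast_sub (by exact_mod_cast h1), Nat.cast_one] at h2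
        have h3 := mainTerm_increment hα hρ.le h1
        have h4 : (pairs G {v} S).card ≤ (pairs (G.comap i) {⟨v, hv⟩} Finset.univ).card := by
          refine le_trans (Finset.card_le_card ?_)
            (Finset.card_image_le (f := fun q : S × S => (i q.1, i q.2)))
          rintro ⟨x, y⟩ hq
          rw [mem_pairs, Finset.mem_singleton] at hq
          obtain ⟨rfl, hy, hxy⟩ := hq
          rw [Finset.mem_image]
          exact ⟨(⟨x, hv⟩, ⟨y, hy⟩), by rw [mem_pairs]; simpa [i] using hxy, rfl⟩
        have h5 : ((pairs G {v} S).card : ℝ) ≤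
            (pairs (G.comap i) {⟨v, hv⟩} Finset.univ).card := by exact_mod_cast h4
        rw [hcardS]
        linarith)
    let col : V → Bool := fun x => if h : x ∈ S then χ ⟨x, h⟩ else true
    let H : SimpleGraph V :=
      { Adj := fun x y => G.Adj x y ∧ x ∈ S ∧ y ∈ S ∧ col x ≠ col y
        symm := ⟨fun x y h => ⟨h.1.symm, h.2.2.1, h.2.1, h.2.2.2.symm⟩⟩
        loopless := ⟨fun x h => G.loopless.irrefl x h.1⟩ }
    have hbip : H.IsBipartite := by
      have : H.Coloring Bool := ⟨col, fun h => h.2.2.2⟩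
      simpa using this.colorable
    have hpH : ((pairs H Finset.univ Finset.univ).card : ℝ) = 2 * numEdges H := by
      exact_mod_cast card_pairs_univ H
    refine ⟨S.card, H, fun x y h => h.1, hbip, hSw, ?_, ?_⟩
    · have hsub : pairs G S S ⊆ pairs H Finset.univ Finset.univ ∪
          ((pairs (G.comap i) Finset.univ Finset.univ).filter
            fun q => χ q.1 = χ q.2).image fun q => (i q.1, i q.2) := by
        rintro ⟨x, y⟩ hq
        rw [mem_pairs] at hq
        obtain ⟨hx, hy, hxy⟩ := hq
        rw [Finset.mem_union]
        by_cases hc : col x = col y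
        · right
          rw [Finset.mem_image]
          refine ⟨(⟨x, hx⟩, ⟨y, hy⟩), Finset.mem_filter.2 ⟨?_, ?_⟩, rfl⟩
          · rw [mem_pairs]
            exact ⟨Finset.mem_univ _, Finset.mem_univ _, hxy⟩
          · simpa [col, hx, hy] using hc
        · left
          rw [mem_pairs]
          exact ⟨Finset.mem_univ _, Finset.mem_univ _, hxy, hx, hy, hc⟩
      have h1 := (Finset.card_le_card hsub).trans ((Finset.card_union_le _ _).trans
        (add_le_add_right (Finset.card_image_le.trans hχ) _))
      rw [hcardS] at h1
      have h2 : ((pairs G S S).card : ℝ) ≤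
          (pairs H Finset.univ Finset.univ).card + L * (4 * k * S.card) := by exact_mod_cast h1
      have h3 : (0 : ℝ) ≤ (N : ℝ) * N := by positivity
      rw [hpH] at h2
      linarith
    · have hdis : Disjoint (S.filter fun x => col x = true) (S.filter fun x => ¬ col x = true) :=
        Finset.disjoint_filter_filter_not _ _ _
      have h1 := card_pairs_le_mainTerm (by linarith) hα hα2 hρ.le hC.le hz hG hdis
      rw [Finset.card_filter_add_card_filter_not] at h1
      have hsub : pairs H Finset.univ Finset.univ ⊆
          pairs G (S.filter fun x => col x = true) (S.filter fun x => ¬ col x = true) ∪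
          pairs G (S.filter fun x => ¬ col x = true) (S.filter fun x => col x = true) := by
        intro q hq
        rw [mem_pairs] at hq
        obtain ⟨-, -, h1, h2, h3, h4⟩ := hq
        simp only [Finset.mem_union, mem_pairs, Finset.mem_filter]
        revert h4
        cases col q.1 <;> cases col q.2 <;> simp [h1, h2, h3]
      have h2 := (Finset.card_le_card hsub).trans (Finset.card_union_le _ _)
      rw [card_pairs_comm G (S.filter fun x => ¬ col x = true)] at h2
      have h2' : ((pairs H Finset.univ Finset.univ).card : ℝ) ≤
          (pairs G (S.filter fun x => col x = true) (S.filter fun x => ¬ col x = true)).card +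
          (pairs G (S.filter fun x => col x = true) (S.filter fun x => ¬ col x = true)).card := by
        exact_mod_cast h2
      have h3 : C * (S.card : ℝ) ^ β ≤ C * (Fintype.card V : ℝ) ^ β := by
        gcongr
      have h4 : (0 : ℝ) ≤ (N : ℝ) * N := by positivity
      rw [hpH] at h2'
      linarith

end Structure

/-! ### Comparison of the extremal numbers -/

section Extremal

variable {F : GraphFamily} {α β ρ C : ℝ}

lemma numEdges_le_ex {n : ℕ} {G : SimpleGraph (Fin n)} (hG : F.IsFree G) :
    numEdges G ≤ ex n F := by
  refine le_csSup ⟨numEdges (⊤ : SimpleGraph (Fin n)), ?_⟩ ⟨G, hG, rfl⟩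
  rintro e ⟨G, -, rfl⟩
  exact numEdges_mono le_top

lemma numEdges_le_z {n : ℕ} {G : SimpleGraph (Fin n)} (hb : G.IsBipartite) (hG : F.IsFree G) :
    numEdges G ≤ z n F := by
  refine le_csSup ⟨numEdges (⊤ : SimpleGraph (Fin n)), ?_⟩ ⟨G, hb, hG, rfl⟩
  rintro e ⟨G, -, -, rfl⟩
  exact numEdges_mono le_top

lemma sSup_nat_le {s : Set ℕ} {b : ℕ} (h : ∀ e ∈ s, e ≤ b) : sSup s ≤ b := by
  rcases s.eq_empty_or_nonempty with rfl | hs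
  · simp
  · exact csSup_le hs h

lemma zz_le_z (m n : ℕ) (F : GraphFamily) : zz m n F ≤ z (m + n) F := by
  refine sSup_nat_le ?_
  rintro e ⟨G, hle, hG, rfl⟩
  let φ : SimpleGraph.comap finSumFinEquiv.symm G ≃g G := SimpleGraph.Iso.comap finSumFinEquiv.symm G
  have h1 : numEdges G = numEdges (SimpleGraph.comap finSumFinEquiv.symm G) := by
    rw [numEdges, numEdges, ← Nat.card_coe_set_eq, ← Nat.card_coe_set_eq]
    exact (Nat.card_congr φ.mapEdgeSet).symm
  have hb : G.IsBipartite := by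
    have : G.Coloring Bool := (SimpleGraph.CompleteBipartiteGraph.bicoloring _ _).comp
      (SimpleGraph.Hom.ofLE hle)
    simpa using this.colorable
  rw [h1]
  refine numEdges_le_z ?_ (hG.of_isContained ⟨φ.toCopy⟩)
  exact hb.of_hom φ.toHom

lemma not_isContained_cycleGraph_of_isBipartite {V : Type} {G : SimpleGraph V}
    (hG : G.IsBipartite) {k : ℕ} (hk : Odd k) (hk3 : 3 ≤ k) :
    (SimpleGraph.cycleGraph k).Free G := by
  rintro ⟨f⟩
  have h1 : (SimpleGraph.cycleGraph k).Colorable 2 := hG.of_hom f.toHom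
  have h2 := h1.chromaticNumber_le
  rw [SimpleGraph.chromaticNumber_cycleGraph_of_odd k (by omega) hk] at h2
  exact absurd h2 (by decide)

lemma isFree_union_cycle {V : Type} {G : SimpleGraph V} {k : ℕ} :
    (F ∪ cycle k).IsFree G ↔ F.IsFree G ∧ (SimpleGraph.cycleGraph k).Free G := by
  constructor
  · exact fun h => ⟨fun A hA => h A (Or.inl hA), h ⟨k, SimpleGraph.cycleGraph k⟩ (Or.inr rfl)⟩
  · rintro ⟨h1, h2⟩ A (hA | rfl)
    · exact h1 A hA
    · exact h2

lemma z_le_ex_union_cycle (n : ℕ) {k : ℕ} (hk : Odd k) (hk3 : 3 ≤ k) :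
    z n F ≤ ex n (F ∪ cycle k) := by
  refine sSup_nat_le ?_
  rintro e ⟨G, hb, hG, rfl⟩
  exact numEdges_le_ex
    (isFree_union_cycle.2 ⟨hG, not_isContained_cycleGraph_of_isBipartite hb hk hk3⟩)

/-- Use the balanced split; rounding costs at most `ρ * (n / 2) ^ (α - 1)`, absorbed because `α - 1
< 1 ≤ β`. -/
lemma mainTerm_sub_le_z (hβ : 1 ≤ β) (hα : 1 < α) (hα2 : α < 2) (hρ : 0 < ρ) (hC : 0 ≤ C)
    (hz : ∀ m n : ℕ, m ≤ n → ρ * m * (n : ℝ) ^ (α - 1) - C * (n : ℝ) ^ β ≤ (zz m n F : ℝ))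
    {n : ℕ} (hn : 1 ≤ n) : mainTerm ρ α n - (ρ + C) * (n : ℝ) ^ β ≤ (z n F : ℝ) := by
  have h1 := hz (n / 2) (n - n / 2) (by omega)
  have h2 := zz_le_z (n / 2) (n - n / 2) F
  rw [show n / 2 + (n - n / 2) = n by omega] at h2
  have h2' : (zz (n / 2) (n - n / 2) F : ℝ) ≤ z n F := by exact_mod_cast h2
  have hn' : (1 : ℝ) ≤ n := by exact_mod_cast hn
  have ha : ((n : ℝ) - 1) / 2 ≤ ((n / 2 : ℕ) : ℝ) := by
    have : (n : ℝ) ≤ 2 * ((n / 2 : ℕ) : ℝ) + 1 := by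
      exact_mod_cast (by omega : n ≤ 2 * (n / 2) + 1)
    linarith
  have hb : (n : ℝ) / 2 ≤ ((n - n / 2 : ℕ) : ℝ) := by
    have : (n : ℝ) ≤ 2 * ((n - n / 2 : ℕ) : ℝ) := by
      exact_mod_cast (by omega : n ≤ 2 * (n - n / 2))
    linarith
  have h3 : ((n - n / 2 : ℕ) : ℝ) ^ β ≤ (n : ℝ) ^ β :=
    Real.rpow_le_rpow (by positivity) (by exact_mod_cast Nat.sub_le _ _) (by linarith)
  have h4 : ((n : ℝ) / 2) ^ (α - 1) ≤ ((n - n / 2 : ℕ) : ℝ) ^ (α - 1) :=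
    Real.rpow_le_rpow (by positivity) hb (by linarith)
  have h5 : ((n : ℝ) / 2) ^ (α - 1) ≤ (n : ℝ) ^ β :=
    (Real.rpow_le_rpow (by positivity) (by linarith) (by linarith)).trans
      (Real.rpow_le_rpow_of_exponent_le hn' (by linarith))
  have h6 : ((n : ℝ) / 2) ^ α = n / 2 * ((n : ℝ) / 2) ^ (α - 1) := by
    rw [← Real.rpow_one_add' (by positivity) (by linarith)]; congr 1; ring
  have h7 : ρ * (((n : ℝ) - 1) / 2) * ((n : ℝ) / 2) ^ (α - 1) ≤
      ρ * ((n / 2 : ℕ) : ℝ) * ((n - n / 2 : ℕ) : ℝ) ^ (α - 1) := by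
    gcongr
  have h8 : C * ((n - n / 2 : ℕ) : ℝ) ^ β ≤ C * (n : ℝ) ^ β := by gcongr
  have h9 : ρ * ((n : ℝ) / 2) ^ (α - 1) ≤ ρ * (n : ℝ) ^ β := by gcongr
  have h10 : 0 ≤ ρ * ((n : ℝ) / 2) ^ (α - 1) := by positivity
  rw [mainTerm, h6]
  linarith

lemma eventually_mul_rpow_le_mainTerm (hβα : β < α) (hρ : 0 < ρ) (M : ℝ) {ε : ℝ} (hε : 0 < ε) :
    ∀ᶠ n : ℕ in atTop, M * (n : ℝ) ^ β ≤ ε * mainTerm ρ α n := by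
  have h := ((tendsto_rpow_atTop (sub_pos.2 hβα)).comp
    tendsto_natCast_atTop_atTop).eventually_ge_atTop (M * 2 ^ α / (ε * ρ))
  filter_upwards [h, eventually_gt_atTop 0] with n hn hn0
  have hn0' : (0 : ℝ) < n := by exact_mod_cast hn0
  simp only [Function.comp_apply] at hn
  rw [div_le_iff₀ (by positivity)] at hn
  rw [mainTerm, Real.div_rpow hn0'.le (by norm_num), show α = (α - β) + β by ring,
    Real.rpow_add hn0', show (α - β) + β = α by ring]
  have h2 : (0 : ℝ) < 2 ^ α := by positivity
  rw [show ε * (ρ * ((n : ℝ) ^ (α - β) * (n : ℝ) ^ β / 2 ^ α)) =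
    ((n : ℝ) ^ (α - β) * (ε * ρ)) * (n : ℝ) ^ β / 2 ^ α by ring, le_div_iff₀ h2]
  calc M * (n : ℝ) ^ β * 2 ^ α = (M * 2 ^ α) * (n : ℝ) ^ β := by ring
    _ ≤ _ := by gcongr

lemma IsExtremal.isAsymptoticallyExtremal {𝒢 : GraphFamily} (h : IsExtremal F 𝒢) :
    IsAsymptoticallyExtremal F 𝒢 := by
  refine ⟨fun G hG => (h G hG).1, fun ε hε => ⟨0, fun G hG _ => ?_⟩⟩
  rw [(h G hG).2]
  have : (0 : ℝ) ≤ ex G.1 F := by positivity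
  nlinarith

end Extremal

end GraphFamily

/-! ### The theorem -/

open GraphFamily in
theorem theorem1p4 (F : GraphFamily) (α β ρ : ℝ) (hβ : 1 ≤ β) (hβα : β < α) (hα : α < 2)
    (hρ : 0 < ρ) (hF : F.IsSmoothWith α β ρ) :
    ∃ k₀ : ℕ, ∀ k : ℕ, k₀ ≤ k → Odd k →
      (∀ 𝒢 : GraphFamily,
        GraphFamily.IsExtremal (F ∪ GraphFamily.cycle k) 𝒢 → 𝒢.IsNearBipartite) ∧
      (∀ 𝒢 : GraphFamily,
        GraphFamily.IsAsymptoticallyExtremal (F ∪ GraphFamily.cycle k) 𝒢 →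
          𝒢.IsNearBipartite) ∧
      (fun n : ℕ => (GraphFamily.ex n (F ∪ GraphFamily.cycle k) : ℝ)) ~[atTop]
        (fun n : ℕ => (GraphFamily.z n F : ℝ)) := by
  obtain ⟨-, C₀, hC₀⟩ := hF
  set C : ℝ := |C₀| + 1 with hCdef
  have hC : 0 < C := by positivity
  have hC' : ∀ n : ℕ, C₀ * (n : ℝ) ^ β ≤ C * (n : ℝ) ^ β := fun n =>
    mul_le_mul_of_nonneg_right (by linarith [le_abs_self C₀]) (by positivity)
  have hzu : ∀ m n : ℕ, m ≤ n →
      (zz m n F : ℝ) ≤ ρ * m * (n : ℝ) ^ (α - 1) + C * (n : ℝ) ^ β := by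
    intro m n hmn
    linarith [(abs_le.1 ((hC₀ m n hmn).trans (hC' n))).2]
  have hzl : ∀ m n : ℕ, m ≤ n →
      ρ * m * (n : ℝ) ^ (α - 1) - C * (n : ℝ) ^ β ≤ (zz m n F : ℝ) := by
    intro m n hmn
    linarith [(abs_le.1 ((hC₀ m n hmn).trans (hC' n))).1]
  have hα1 : 1 < α := by linarith
  obtain ⟨k₀, hk₀⟩ := exists_bipartite_subgraph hβ hβα hα hρ hC hzu
  -- For `k = 1` the graph `cycleGraph k` is a single vertex, not an odd cycle.
  refine ⟨max k₀ 3, fun k hk hodd => ?_⟩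
  have hk3 : 3 ≤ k := (le_max_right _ _).trans hk
  obtain ⟨K, hK, hstr⟩ := hk₀ k ((le_max_left _ _).trans hk) hodd
  have hzn : ∀ n : ℕ, 1 ≤ n → mainTerm ρ α n - (ρ + C) * (n : ℝ) ^ β ≤ (z n F : ℝ) :=
    fun n hn => mainTerm_sub_le_z hβ hα1 hα hρ hC.le hzl hn
  have hzex : ∀ n : ℕ, (z n F : ℝ) ≤ ex n (F ∪ cycle k) := fun n => by
    exact_mod_cast z_le_ex_union_cycle n hodd hk3
  have hex : ∀ n : ℕ, 1 ≤ n → (ex n (F ∪ cycle k) : ℝ) ≤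
      mainTerm ρ α n + 2 * K * (n : ℝ) ^ β := by
    intro n hn
    rw [← Nat.le_floor_iff (by rw [mainTerm]; positivity)]
    refine sSup_nat_le ?_
    rintro e ⟨G, hG, rfl⟩
    rw [Nat.le_floor_iff (by rw [mainTerm]; positivity)]
    have : Nonempty (Fin n) := ⟨⟨0, hn⟩⟩
    obtain ⟨s, H, -, -, h0, h1, h2⟩ := hstr (Fin n) G (isFree_union_cycle.1 hG).1
      (isFree_union_cycle.1 hG).2
    rw [Fintype.card_fin] at h0 h1 h2
    linarith
  have hnear : ∀ 𝒢 : GraphFamily, IsAsymptoticallyExtremal (F ∪ cycle k) 𝒢 →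
      𝒢.IsNearBipartite := by
    intro 𝒢 h𝒢 ε hε
    -- With p = n^β, near-extremality against e(G) ≤ (w(n) + w(s))/2 + 2Kp gives (w(n) - w(s))/2 ≤
    -- δw(n) + (ρ + C + 2K)p. Another Kp bounds e(G) - e(H), in all at most εw(n)/4, while e(G) ≥
    -- w(n)/4.
    obtain ⟨N, hN⟩ := h𝒢.2 (min (ε / 8) (1 / 2)) (by positivity)
    obtain ⟨N', hN'⟩ := eventually_atTop.1 ((eventually_mul_rpow_le_mainTerm hβα hρ
      (ρ + C + 3 * K) (ε := min (ε / 8) (1 / 4)) (by positivity)).and (eventually_ge_atTop 1))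
    refine ⟨max N N', fun G hG hn => ?_⟩
    obtain ⟨hmain, hn1⟩ := hN' G.1 ((le_max_right _ _).trans hn)
    have hGex := hN G hG ((le_max_left _ _).trans hn)
    have : Nonempty (Fin G.1) := ⟨⟨0, hn1⟩⟩
    have hGfree := isFree_union_cycle.1 (h𝒢.1 G hG)
    obtain ⟨s, H, hHG, hb, -, h1, h2⟩ := hstr (Fin G.1) G.2 hGfree.1 hGfree.2
    rw [Fintype.card_fin] at h1 h2
    refine ⟨H, hHG, hb, ?_⟩
    have hw : 0 ≤ mainTerm ρ α (G.1 : ℝ) := by rw [mainTerm]; positivity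
    have hp : 0 ≤ (G.1 : ℝ) ^ β := by positivity
    have hlow := (hzn G.1 hn1).trans (hzex G.1)
    set w := mainTerm ρ α (G.1 : ℝ)
    set p := (G.1 : ℝ) ^ β
    have hKp : 0 ≤ K * p := by positivity
    have hCp : 0 ≤ (ρ + C) * p := by positivity
    set δ := min (ε / 8) (1 / 2)
    have hδ1 : δ ≤ ε / 8 := min_le_left _ _
    have hδ2 : δ ≤ 1 / 2 := min_le_right _ _
    have hδ0 : 0 < δ := by positivity
    have hm1 : (ρ + C + 3 * K) * p ≤ ε / 8 * w :=
      hmain.trans (mul_le_mul_of_nonneg_right (min_le_left _ _) hw)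
    have hm2 : (ρ + C + 3 * K) * p ≤ 1 / 4 * w :=
      hmain.trans (mul_le_mul_of_nonneg_right (min_le_right _ _) hw)
    have hδw : δ * w ≤ ε / 8 * w := mul_le_mul_of_nonneg_right hδ1 hw
    have hδw' : δ * w ≤ 1 / 2 * w := mul_le_mul_of_nonneg_right hδ2 hw
    have hδp : 0 ≤ δ * ((ρ + C) * p) := by positivity
    have hG1 : (1 - δ) * (w - (ρ + C) * p) ≤ numEdges G.2 :=
      (mul_le_mul_of_nonneg_left hlow (by linarith)).trans hGex
    have hG2 : w - δ * w - (ρ + C) * p ≤ numEdges G.2 := by linarith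
    have hG3 : w / 4 ≤ numEdges G.2 := by linarith
    have hG4 : ε * (w / 4) ≤ ε * numEdges G.2 := mul_le_mul_of_nonneg_left hG3 hε.le
    linarith
  refine ⟨fun 𝒢 h => hnear 𝒢 h.isAsymptoticallyExtremal, hnear, ?_⟩
  rw [IsEquivalent, isLittleO_iff]
  intro ε hε
  filter_upwards [eventually_mul_rpow_le_mainTerm hβα hρ (ρ + C + 2 * K)
    (ε := min (ε / 2) (1 / 2)) (by positivity), eventually_ge_atTop 1] with n hn hn1
  have hw : 0 ≤ mainTerm ρ α (n : ℝ) := by rw [mainTerm]; positivity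
  have hp : 0 ≤ (n : ℝ) ^ β := by positivity
  have h1 := hex n hn1
  have h2 := hzn n hn1
  have h3 := hzex n
  rw [Pi.sub_apply, Real.norm_of_nonneg (by linarith), Real.norm_of_nonneg (by positivity)]
  have hm1 := hn.trans (mul_le_mul_of_nonneg_right (min_le_left _ _) hw)
  have hm2 := hn.trans (mul_le_mul_of_nonneg_right (min_le_right _ _) hw)
  have hKp : 0 ≤ K * (n : ℝ) ^ β := by positivity
  have hz2 : mainTerm ρ α (n : ℝ) / 2 ≤ z n F := by linarith
  have hz3 : ε * (mainTerm ρ α (n : ℝ) / 2) ≤ ε * z n F := mul_le_mul_of_nonneg_left hz2 hε.le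
  linarith
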